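/- Let $M$ be a matroid on a finite ground set with at least two elements, and suppose that $M$ is graphic (it is the cycle matroid of a graph, where loops and multiple edges are allowed) or cographic (its dual is graphic). Then $$\beta(M)\cdot \mathrm{rk}(M) = (-1)^{\mathrm{rk}(M)}\sum_{A\subseteq M} (-1)^{|A|}\, c(A),$$ where the sum runs over all subsets $A$ of the ground set of $M$. Here $\mathrm{rk}$ is the rank function of $M$, $$\beta(M) = (-1)^{\mathrm{rk}(M)}\sum_{A\subseteq M} (-1)^{|A|}\,\mathrm{rk}(A)$$ is Crapo's invariant, and $c(A)$ is the number of connected components of the restriction $M|A$, that is, the largest integer $k$ such that $M|A$ is a direct sum of $k$ non-empty matroids (so $c(\emptyset)=0$). -/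

import Mathlib

universe u v

namespace CrapoInvariant

/-- `C` is the edge set of a cycle of the multigraph `G`: there are `n + 1 ≥ 1` distinct vertices
`v 0, …, v n` and distinct edges `e 0, …, e n`, forming the set `C`, such that `e i` joins `v i`
to `v (i + 1)`, where the indices are read cyclically (addition in `Fin (n + 1)` wraps around).
So a loop is a cycle with one edge, and two parallel edges form a cycle with two edges. -/
def IsCycleEdgeSet {V : Type v} {α : Type u} (G : Graph V α) (C : Set α) : Prop :=
  ∃ (n : ℕ) (v : Fin (n + 1) → V) (e : Fin (n + 1) → α),
    Function.Injective v ∧ Function.Injective e ∧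
      (∀ i, G.IsLink (e i) (v i) (v (i + 1))) ∧ Set.range e = C

/-- `M` is the cycle matroid of the multigraph `G`: its elements are the edges of `G`, and its
circuits are the edge sets of the cycles of `G`. -/
def IsCycleMatroid {V : Type v} {α : Type u} (G : Graph V α) (M : Matroid α) : Prop :=
  M.E = G.edgeSet ∧ ∀ C : Set α, M.IsCircuit C ↔ IsCycleEdgeSet G C

/-- A matroid is graphic if it is the cycle matroid of some multigraph. -/
def IsGraphic {α : Type u} (M : Matroid α) : Prop :=
  ∃ (V : Type v) (G : Graph V α), IsCycleMatroid G M

/-- A matroid is cographic if its dual is graphic. -/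
def IsCographic {α : Type u} (M : Matroid α) : Prop :=
  IsGraphic.{u, v} M✶

/-- The rank of a matroid, as a natural number (used for matroids on finite sets only). -/
noncomputable def rank {α : Type u} (M : Matroid α) : ℕ := M.eRank.toNat

/-- `M` is the direct sum of `k` matroids with non-empty, pairwise disjoint ground sets. -/
def IsDirectSumOf {α : Type u} (M : Matroid α) (k : ℕ) : Prop :=
  ∃ (N : Fin k → Matroid α) (h : Pairwise (Function.onFun Disjoint fun i => (N i).E)),
    (∀ i, (N i).E.Nonempty) ∧ M = Matroid.disjointSigma N h

/-- The number `c(M)` of connected components of a matroid `M` (on a finite set): the largest `k`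
such that `M` is a direct sum of `k` non-empty matroids. -/
noncomputable def numComponents {α : Type u} (M : Matroid α) : ℕ :=
  sSup {k : ℕ | IsDirectSumOf M k}

/-- For a finite matroid the supremum that defines `numComponents` is a maximum. -/
theorem isGreatest_numComponents {α : Type u} (M : Matroid α) [M.Finite] :
    IsGreatest {k : ℕ | IsDirectSumOf M k} (numComponents M) := by
  have hne : {k : ℕ | IsDirectSumOf M k}.Nonempty := by
    rcases M.E.eq_empty_or_nonempty with h | h
    · have hp : Pairwise (Function.onFun Disjoint fun i : Fin 0 => (Fin.elim0 i : Matroid α).E) :=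
        fun i => i.elim0
      refine ⟨0, fun i => Fin.elim0 i, hp, fun i => i.elim0, ?_⟩
      rw [Matroid.ground_eq_empty_iff.1 h]
      symm
      rw [← Matroid.ground_eq_empty_iff]
      simp
    · have hp : Pairwise (Function.onFun Disjoint fun _ : Fin 1 => M.E) :=
        fun i j hij => (hij (Subsingleton.elim i j)).elim
      refine ⟨1, fun _ => M, hp, fun _ => h, ?_⟩
      have hU : (⋃ _ : Fin 1, M.E) = M.E := Set.iUnion_const _
      refine Matroid.ext_indep ?_ fun I hI => ?_
      · rw [Matroid.disjointSigma_ground_eq, hU]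
      · rw [Matroid.disjointSigma_indep_iff, hU, Set.inter_eq_left.2 hI]
        exact ⟨fun h => ⟨fun _ => h, hI⟩, fun h => h.1 0⟩
  have hbdd : BddAbove {k : ℕ | IsDirectSumOf M k} := by
    refine ⟨M.E.ncard, ?_⟩
    rintro k ⟨N, h, hN, rfl⟩
    choose f hf using hN
    have hinj : Function.Injective f := fun i j hij => by
      by_contra hne
      exact Set.disjoint_left.1 (h hne) (hf i) (hij ▸ hf j)
    have hsub : Set.range f ⊆ (Matroid.disjointSigma N h).E := by
      rintro _ ⟨i, rfl⟩
      simpa using ⟨i, hf i⟩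
    have := Set.ncard_le_ncard hsub (Matroid.ground_finite _)
    rwa [Set.ncard_range_of_injective hinj, Nat.card_fin] at this
  exact ⟨Nat.sSup_mem hne hbdd, fun k hk => le_csSup hbdd hk⟩

/-- The finite collection of all subsets of the ground set of a finite matroid. -/
noncomputable def subsets {α : Type u} (M : Matroid α) [M.Finite] : Finset (Finset α) :=
  M.ground_finite.toFinset.powerset

/-- Crapo's invariant `β(M) = (-1) ^ rk(M) * ∑_{A ⊆ M} (-1) ^ |A| * rk(A)`, where `rk(A)` is the
rank of the restriction of `M` to `A`. -/
noncomputable def beta {α : Type u} (M : Matroid α) [M.Finite] : ℤ :=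
  (-1) ^ rank M * ∑ A ∈ subsets M, (-1) ^ A.card * (rank (M.restrict (A : Set α)) : ℤ)

end CrapoInvariant

/-! Let R be the alternating sum of the ranks; the claim amounts to: the alternating sum of the c(A)
is rk(M) · R. A multigraph enters through its potentials, the functions on the vertices that are
constant along the edges of A. For finite V their dimension is the number of components of (V, A),
which determines rk(A) (`rank_restrict_add_finrank`).

The key is `IsRepresentedBy.numComponents_eq`, which expresses c through ranks: c(M) = #loops + (|V|
- 1) rk(M) - ∑_v rk(M \ star v). It is checked on each component: a loopless block D with vertex set
V(D) has rank |V(D)| - 1, and deleting the star of v lowers this rank by one if v ∈ V(D) and by zero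
otherwise.

Graphic case: apply the formula to every M|A and sum with signs. A summand that does not change when
a fixed element is toggled cancels (`sum_powerset_eq_zero_of_insert`). This kills the loop and star
terms and leaves (|V| - 1) R. Without isolated vertices, either the graph is connected and |V| - 1 =
rk(M), or M is a proper direct sum and R = 0.

Cographic case, M = N✶: as c is invariant under duality, c(M|A) = c(N/(E \ A)), and a contraction is
represented by the quotient graph. The formula for N/B involves |cl(B)|, with alternating sum |E| ·
R_N, and the ranks of N minus the edge boundary of a component of (V, B), with alternating sum R_N
(`sum_powerset_sum_isFiber`). The total is (|E| - rk(N)) R_N = rk(N✶) R_N, and complementing subsets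
contributes the same sign (-1)^|E| to both sides. -/

namespace CrapoInvariant

open Module

/-! ### Potentials of a multigraph and the rank function. -/

section Potentials

variable {V : Type v} {α : Type u}

/-- The functions on the vertices that take equal values at the two ends `s e`, `t e` of each edge
`e` in `A`. -/
def potentials (s t : α → V) (A : Set α) : Submodule ℚ (V → ℚ) where
  carrier := {f | ∀ e ∈ A, f (s e) = f (t e)}
  add_mem' hf hg e he := by simp [hf e he, hg e he]
  zero_mem' _ _ := rfl
  smul_mem' c f hf e he := by simp [hf e he]

/-- The closure operator of `M` is that of the multigraph in which the element `e` of `M` joins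
`s e` and `t e`. -/
def IsRepresentedBy (M : Matroid α) (s t : α → V) : Prop :=
  ∀ A ⊆ M.E, ∀ e ∈ M.E, e ∈ M.closure A ↔ ∀ f ∈ potentials s t A, f (s e) = f (t e)

variable {s t : α → V} {A B : Set α} {M : Matroid α}

theorem potentials_anti (h : A ⊆ B) : potentials s t B ≤ potentials s t A :=
  fun _ hf e he => hf e (h he)

theorem potentials_insert_of_forall {e : α} (h : ∀ f ∈ potentials s t A, f (s e) = f (t e)) :
    potentials s t (insert e A) = potentials s t A := by
  refine le_antisymm (potentials_anti (Set.subset_insert _ _)) fun f hf a ha => ?_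
  rcases ha with rfl | ha
  exacts [h f hf, hf a ha]

/-- The edge `e` imposes one further linear condition, and `f` shows that it is not vacuous. -/
theorem finrank_potentials_insert [Finite V] {e : α} {f : V → ℚ}
    (hf : f ∈ potentials s t A) (hfe : f (s e) ≠ f (t e)) :
    finrank ℚ (potentials s t (insert e A)) + 1 = finrank ℚ (potentials s t A) := by
  let φ : Dual ℚ (potentials s t A) :=
    (LinearMap.proj (R := ℚ) (φ := fun _ : V => ℚ) (s e) - LinearMap.proj (t e)).comp
      (potentials s t A).subtype
  have hφ : φ ≠ 0 := fun h => hfe (sub_eq_zero.1 (LinearMap.congr_fun h ⟨f, hf⟩))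
  have hmap : (LinearMap.ker φ).map (potentials s t A).subtype = potentials s t (insert e A) := by
    ext g
    simp only [Submodule.mem_map, LinearMap.mem_ker, Submodule.subtype_apply, Subtype.exists,
      exists_and_right, exists_eq_right]
    constructor
    · rintro ⟨hg, h⟩ a (rfl | ha)
      exacts [sub_eq_zero.1 h, hg a ha]
    · intro hg
      exact ⟨fun a ha => hg a (Or.inr ha), sub_eq_zero.2 (hg e (Or.inl rfl))⟩
  rw [← hmap, Submodule.finrank_map_subtype_eq]
  exact Dual.finrank_ker_add_one_of_ne_zero hφ

theorem finrank_potentials_empty [Fintype V] :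
    finrank ℚ (potentials s t ∅) = Fintype.card V := by
  have : potentials s t ∅ = ⊤ := eq_top_iff.2 fun _ _ _ he => he.elim
  rw [this, finrank_top, finrank_fintype_fun_eq_card]

theorem rank_restrict_add_finrank [Fintype V] [M.Finite] (hM : IsRepresentedBy M s t)
    (hA : A ⊆ M.E) :
    rank (M.restrict A) + finrank ℚ (potentials s t A) = Fintype.card V := by
  have hfin : A.Finite := M.ground_finite.subset hA
  induction A, hfin using Set.Finite.induction_on with
  | empty =>
    simp [rank, finrank_potentials_empty]
  | @insert e A heA hfin ih =>
    have hA' : A ⊆ M.E := (Set.subset_insert _ _).trans hA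
    have heE : e ∈ M.E := hA (Set.mem_insert _ _)
    have ih := ih hA'
    by_cases he : e ∈ M.closure A
    · rw [potentials_insert_of_forall ((hM A hA' e heE).1 he), ← ih]
      congr 1
      simp only [rank, Matroid.eRank_restrict]
      rw [← Matroid.eRk_insert_closure_eq, Set.insert_eq_of_mem he, Matroid.eRk_closure_eq]
    · have h1 := Matroid.eRk_insert_eq_add_one (M := M) (X := A) (e := e) ⟨heE, he⟩
      rw [hM A hA' e heE] at he
      push Not at he
      obtain ⟨f, hf, hfe⟩ := he
      have h2 := finrank_potentials_insert hf hfe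
      have h3 : rank (M.restrict (insert e A)) = rank (M.restrict A) + 1 := by
        simp only [rank, Matroid.eRank_restrict]
        rw [h1, ENat.toNat_add ((M.isRkFinite_of_finite hfin).eRk_lt_top.ne) (by simp)]
        rfl
      omega

/-- The functions that are constant on the nonempty set `S` form a space of dimension
`|V| - |S| + 1`. -/
theorem finrank_constOn [Fintype V] [DecidableEq V] {S : Finset V} {v₀ : V} (hv₀ : v₀ ∈ S)
    {W : Submodule ℚ (V → ℚ)} (hW : ∀ f, f ∈ W ↔ ∀ u ∈ S, f u = f v₀) :
    finrank ℚ W + S.card = Fintype.card V + 1 := by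
  let φ : W →ₗ[ℚ] ({u // u ∉ S.erase v₀} → ℚ) :=
    (LinearMap.funLeft ℚ ℚ (Subtype.val : {u // u ∉ S.erase v₀} → V)).comp W.subtype
  have hφ : Function.Bijective φ := by
    constructor
    · intro f g hfg
      have h (u) (hu : u ∉ S.erase v₀) : f.1 u = g.1 u := congr_fun hfg ⟨u, hu⟩
      ext u
      by_cases hu : u ∈ S
      · rw [(hW _).1 f.2 u hu, (hW _).1 g.2 u hu]
        exact h v₀ (by simp)
      · exact h u (by simp [hu])
    · intro g
      refine ⟨⟨fun u => if hu : u ∉ S.erase v₀ then g ⟨u, hu⟩ else g ⟨v₀, by simp⟩, ?_⟩, ?_⟩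
      · rw [hW]
        intro u hu
        by_cases huv : u = v₀
        · rw [huv]
        · simp [hu, huv]
      · ext ⟨u, hu⟩
        exact dif_pos hu
  rw [(LinearEquiv.ofBijective φ hφ).finrank_eq, finrank_fintype_fun_eq_card,
    Fintype.card_subtype_compl, Fintype.card_coe, Finset.card_erase_of_mem hv₀]
  have := Finset.card_le_univ S
  have := Finset.card_pos.2 ⟨v₀, hv₀⟩
  omega

theorem IsRepresentedBy.isLoop_iff (hM : IsRepresentedBy M s t) {e : α} (he : e ∈ M.E) :
    M.IsLoop e ↔ s e = t e := by
  classical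
  rw [Matroid.isLoop_iff, Matroid.loops, hM ∅ (Set.empty_subset _) e he]
  constructor
  · intro h
    by_contra hne
    have := h (Pi.single (s e) 1) fun _ h => h.elim
    rw [Pi.single_eq_same, Pi.single_eq_of_ne (Ne.symm hne)] at this
    exact one_ne_zero this
  · intro h f _
    rw [h]

theorem IsRepresentedBy.restrict (hM : IsRepresentedBy M s t) (hA : A ⊆ M.E) :
    IsRepresentedBy (M.restrict A) s t := by
  intro B hB e he
  change B ⊆ A at hB
  change e ∈ A at he
  rw [Matroid.restrict_closure_eq _ hB hA, ← hM B (hB.trans hA) e (hA he)]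
  simp [he]

end Potentials

/-! ### Connected components and duality. -/

section Components

variable {α : Type u} {M : Matroid α}

/-- The function `g` on the elements takes only one value on each circuit of `M`. -/
def ConstOnCircuits {ι : Type*} (M : Matroid α) (g : α → ι) : Prop :=
  ∀ ⦃C⦄, M.IsCircuit C → ∀ e ∈ C, ∀ f ∈ C, g e = g f

/-- `g` records the summand of each element. Conversely, the fibres of `g` give a direct sum because
a dependent set contains a circuit, which lies in a single fibre. -/
theorem isDirectSumOf_iff {k : ℕ} :
    IsDirectSumOf M k ↔ ∃ g : α → ℕ, (∀ e ∈ M.E, g e < k) ∧ (∀ i < k, ∃ e ∈ M.E, g e = i) ∧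
      ConstOnCircuits M g := by
  classical
  constructor
  · rintro ⟨N, h, hne, rfl⟩
    have hmem (e) : e ∈ (Matroid.disjointSigma N h).E ↔ ∃ i, e ∈ (N i).E := by simp
    let g : α → ℕ := fun e => if he : ∃ i, e ∈ (N i).E then (he.choose : ℕ) else 0
    have hg (i : Fin k) (e) (he : e ∈ (N i).E) : g e = i := by
      have hex : ∃ i, e ∈ (N i).E := ⟨i, he⟩
      simp only [g, dif_pos hex]
      by_contra hne
      exact Set.disjoint_left.1 (h fun heq => hne (congr_arg Fin.val heq)) hex.choose_spec he
    refine ⟨g, fun e he => ?_, fun i hi => ?_, fun C hC e he f hf => ?_⟩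
    · obtain ⟨i, hi⟩ := (hmem e).1 he
      rw [hg i e hi]
      exact i.2
    · obtain ⟨e, he⟩ := hne ⟨i, hi⟩
      exact ⟨e, (hmem e).2 ⟨_, he⟩, hg ⟨i, hi⟩ e he⟩
    · have hdep := hC.not_indep
      rw [Matroid.disjointSigma_indep_iff] at hdep
      have hCE : C ⊆ ⋃ i, (N i).E := by simpa using hC.subset_ground
      obtain ⟨i, hi⟩ : ∃ i, ¬ (N i).Indep (C ∩ (N i).E) := by
        by_contra! hcon
        exact hdep ⟨hcon, hCE⟩
      have hCi : C ∩ (N i).E = C := by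
        refine hC.eq_of_not_indep_subset (fun hind => hi ?_) Set.inter_subset_left
        rw [Matroid.disjointSigma_indep_iff] at hind
        simpa [Set.inter_assoc] using hind.1 i
      rw [hg i e (hCi.symm ▸ he : e ∈ C ∩ (N i).E).2, hg i f (hCi.symm ▸ hf : f ∈ C ∩ (N i).E).2]
  · rintro ⟨g, hlt, hsurj, hconst⟩
    let D : Fin k → Set α := fun i => {e | e ∈ M.E ∧ g e = i}
    have hD : Pairwise (Function.onFun Disjoint fun i => (M.restrict (D i)).E) := by
      intro i j hij
      refine Set.disjoint_left.2 fun e hi hj => hij (Fin.ext ?_)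
      exact hi.2.symm.trans hj.2
    have hU : (⋃ i, D i) = M.E := by
      ext e
      simp only [Set.mem_iUnion, D, Set.mem_ofPred_eq]
      exact ⟨fun ⟨_, h, _⟩ => h, fun h => ⟨⟨g e, hlt e h⟩, h, rfl⟩⟩
    refine ⟨fun i => M.restrict (D i), hD, fun i => ?_, ?_⟩
    · obtain ⟨e, he, hi⟩ := hsurj i i.2
      exact ⟨e, he, hi⟩
    · refine Matroid.ext_indep ?_ fun I hI => ?_
      · rw [Matroid.disjointSigma_ground_eq]
        exact hU.symm
      · rw [Matroid.disjointSigma_indep_iff]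
        simp only [Matroid.restrict_indep_iff, Matroid.restrict_ground_eq, hU]
        refine ⟨fun h => ⟨fun i => ⟨h.subset Set.inter_subset_left, Set.inter_subset_right⟩, hI⟩,
          fun h => ?_⟩
        by_contra hdep
        obtain ⟨C, hCI, hC⟩ := ((Matroid.not_indep_iff hI).1 hdep).exists_isCircuit_subset
        obtain ⟨e, he⟩ := hC.nonempty
        refine hC.not_indep ((h.1 ⟨g e, hlt e (hC.subset_ground he)⟩).1.subset fun f hf => ?_)
        exact ⟨hCI hf, hC.subset_ground hf, hconst hC f hf e he⟩

/-- Two elements `e`, `f` of a cocircuit `K` share a circuit: by minimality of `K` the complement of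
`K \ {f}` is spanning, so it contains all but `e` of a circuit through `e`. This circuit cannot meet
`K` in `e` alone, so it contains `f`. -/
theorem ConstOnCircuits.dual {ι : Type*} {g : α → ι} (h : ConstOnCircuits M g) :
    ConstOnCircuits M✶ g := by
  intro K hK e he f hf
  by_cases hef : e = f
  · rw [hef]
  have hK' : M.IsCocircuit K := hK
  have hKE : K ⊆ M.E := hK.subset_ground
  have hmin := Matroid.isCocircuit_iff_minimal_compl_nonspanning.1 hK'
  have hsp : M.Spanning (M.E \ (K \ {f})) := by
    by_contra hcon
    exact (hmin.le_of_le hcon Set.sdiff_subset hf).2 rfl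
  have hecl : e ∈ M.closure (M.E \ (K \ {f})) := by
    rw [hsp.closure_eq]
    exact hKE he
  obtain ⟨C, hCs, hC, heC⟩ := Matroid.exists_isCircuit_of_mem_closure hecl
    (fun h => h.2 ⟨he, hef⟩)
  by_cases hfC : f ∈ C
  · exact h hC e heC f hfC
  · refine absurd ?_ (hC.inter_isCocircuit_ne_singleton hK' (e := e))
    ext a
    simp only [Set.mem_inter_iff, Set.mem_singleton_iff]
    constructor
    · rintro ⟨ha, haK⟩
      rcases hCs ha with h | h
      · exact h
      · by_contra _
        exact h.2 ⟨haK, fun haf => hfC (haf ▸ ha)⟩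
    · rintro rfl
      exact ⟨heC, he⟩

theorem numComponents_dual (M : Matroid α) : numComponents M✶ = numComponents M := by
  unfold numComponents
  congr 1
  ext k
  simp only [Set.mem_ofPred_eq, isDirectSumOf_iff, Matroid.dual_ground]
  constructor
  · rintro ⟨g, h1, h2, h3⟩
    exact ⟨g, h1, h2, by simpa using h3.dual⟩
  · rintro ⟨g, h1, h2, h3⟩
    exact ⟨g, h1, h2, h3.dual⟩

theorem rank_restrict_eq_ncard [M.Finite] {I Y : Set α} (hI : M.IsBasis I Y) :
    rank (M.restrict Y) = I.ncard := by
  simp only [rank, Matroid.eRank_restrict, hI.eRk_eq_encard, Set.ncard]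

/-- If `g` is constant on circuits then the rank is additive over the fibres of `g`. -/
theorem ConstOnCircuits.rank_eq_sum [M.Finite] {g : α → ℕ} (h : ConstOnCircuits M g) {k : ℕ}
    (hg : ∀ e ∈ M.E, g e < k) {Y : Set α} (hY : Y ⊆ M.E) :
    rank (M.restrict Y) = ∑ i ∈ Finset.range k, rank (M.restrict (Y ∩ {e | g e = i})) := by
  classical
  obtain ⟨I, hI⟩ := M.exists_isBasis Y hY
  have hIE : I ⊆ M.E := hI.subset.trans hY
  have hfin : I.Finite := M.ground_finite.subset hIE
  have hb (i : ℕ) : M.IsBasis (I ∩ {e | g e = i}) (Y ∩ {e | g e = i}) := by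
    rw [Matroid.isBasis_iff_indep_closure]
    refine ⟨hI.indep.subset Set.inter_subset_left, ?_,
      Set.inter_subset_inter_left _ hI.subset⟩
    rintro e ⟨heY, hei⟩
    by_cases heI : e ∈ I
    · exact M.mem_closure_of_mem ⟨heI, hei⟩ (Set.inter_subset_left.trans hIE)
    · obtain ⟨C, hCs, hC, heC⟩ :=
        Matroid.exists_isCircuit_of_mem_closure (hI.subset_closure heY) heI
      refine M.closure_subset_closure ?_ (hC.mem_closure_sdiff_singleton_of_mem heC)
      rintro f ⟨hfC, hfe⟩
      exact ⟨(hCs hfC).resolve_left hfe, (h hC f hfC e heC).trans hei⟩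
  rw [rank_restrict_eq_ncard hI]
  simp_rw [rank_restrict_eq_ncard (hb _)]
  lift I to Finset α using hfin
  rw [Set.ncard_coe_finset, Finset.card_eq_sum_card_fiberwise (f := g) (t := Finset.range k)]
  · refine Finset.sum_congr rfl fun i _ => ?_
    rw [← Set.ncard_coe_finset]
    congr 1
    ext e
    simp
  · intro e he
    simpa using hg e (hIE he)

/-- A decomposition of a finite matroid into its connected components. -/
theorem exists_components (M : Matroid α) [M.Finite] :
    ∃ g : α → ℕ, (∀ e ∈ M.E, g e < numComponents M) ∧ ConstOnCircuits M g ∧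
      ∀ i < numComponents M, {e | e ∈ M.E ∧ g e = i}.Nonempty ∧
        ∀ X ⊆ {e | e ∈ M.E ∧ g e = i}, X.Nonempty →
          (∀ C, M.IsCircuit C → (C ∩ X).Nonempty → C ⊆ X) → X = {e | e ∈ M.E ∧ g e = i} := by
  classical
  obtain ⟨hmem, hub⟩ := isGreatest_numComponents M
  obtain ⟨g, hlt, hsurj, hconst⟩ := isDirectSumOf_iff.1 hmem
  refine ⟨g, hlt, hconst, fun i hi => ⟨hsurj i hi, fun X hX hne hcl => ?_⟩⟩
  by_contra hXne
  obtain ⟨e₀, he₀, he₀X⟩ := Set.exists_of_ssubset (hX.ssubset_of_ne hXne)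
  -- Giving `X` a new label splits a component; the old label `i` is still used by `e₀`.
  have hk : IsDirectSumOf M (numComponents M + 1) := by
    refine isDirectSumOf_iff.2 ⟨fun e => if e ∈ X then numComponents M else g e,
      fun e he => ?_, fun j hj => ?_, fun C hC e he f hf => ?_⟩
    · dsimp only
      split_ifs
      · omega
      · exact (hlt e he).trans (Nat.lt_succ_self _)
    · rcases Nat.lt_succ_iff_lt_or_eq.1 hj with hj | rfl
      · by_cases hji : j = i
        · exact ⟨e₀, he₀.1, by simp [he₀X, he₀.2, hji]⟩
        · obtain ⟨e, he, hej⟩ := hsurj j hj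
          have : e ∉ X := fun heX => hji (hej.symm.trans (hX heX).2)
          exact ⟨e, he, by simp [this, hej]⟩
      · obtain ⟨e, he⟩ := hne
        exact ⟨e, (hX he).1, by simp [he]⟩
    · by_cases hCX : (C ∩ X).Nonempty
      · simp [hcl C hC hCX he, hcl C hC hCX hf]
      · have h (a) (ha : a ∈ C) : a ∉ X := fun haX => hCX ⟨a, ha, haX⟩
        simp [h e he, h f hf, hconst hC e he f hf]
  have := hub hk
  omega

end Components

/-! ### Blocks and the formula for the number of components. -/

section BlockFormula

variable {V : Type v} {α : Type u} {s t : α → V} {M : Matroid α}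

/-- The edges with exactly one end at the vertex `v`. -/
def star (s t : α → V) (v : V) : Set α := {e | s e ≠ t e ∧ (s e = v ∨ t e = v)}

/-- If the edges of `D` that meet `S` meet the other edges of `D` in at most one vertex `v`, then a
circuit in `D` that has an edge meeting `S` has only such edges. -/
theorem IsRepresentedBy.subset_of_separation (hM : IsRepresentedBy M s t) {D X C : Set α}
    {S : Set V} {v : V} (hX : ∀ e ∈ D, e ∈ X ↔ s e ∈ S ∨ t e ∈ S)
    (hSv : ∀ e ∈ D, e ∈ X → (s e ∈ S ∨ s e = v) ∧ (t e ∈ S ∨ t e = v))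
    (hC : M.IsCircuit C) (hCD : C ⊆ D) (hCX : (C ∩ X).Nonempty) : C ⊆ X := by
  classical
  obtain ⟨e, heC, heX⟩ := hCX
  have hCE := hC.subset_ground
  have hcl : e ∈ M.closure ((C ∩ X) \ {e}) := by
    rw [hM _ (Set.sdiff_subset.trans (Set.inter_subset_left.trans hCE)) e (hCE heC)]
    intro f hf
    -- The shift makes `f` vanish at the attaching vertex `v`, so it can be cut off outside `S`
    -- without a jump along edges of `X`.
    let f' : V → ℚ := fun u => if u ∈ S then f u - f v else 0
    have hf' (u) (hu : u ∈ S ∨ u = v) : f' u = f u - f v := by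
      by_cases h : u ∈ S
      · simp [f', h]
      · rw [hu.resolve_left h]
        simp [f']
    have hmem : f' ∈ potentials s t (C \ {e}) := by
      rintro a ⟨haC, hae⟩
      by_cases haX : a ∈ X
      · obtain ⟨h1, h2⟩ := hSv a (hCD haC) haX
        rw [hf' _ h1, hf' _ h2, hf a ⟨⟨haC, haX⟩, hae⟩]
      · rw [hX a (hCD haC), not_or] at haX
        simp [f', haX.1, haX.2]
    have := (hM _ (Set.sdiff_subset.trans hCE) e (hCE heC)).1
      (hC.mem_closure_sdiff_singleton_of_mem heC) f' hmem
    obtain ⟨h1, h2⟩ := hSv e (hCD heC) heX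
    rw [hf' _ h1, hf' _ h2] at this
    linarith
  have hni : ¬ M.Indep (C ∩ X) := fun hind =>
    hind.notMem_closure_sdiff_of_mem ⟨heC, heX⟩ hcl
  rw [← hC.eq_of_not_indep_subset hni Set.inter_subset_left]
  exact Set.inter_subset_right

/-- `D` is a nonempty union of circuits and coloops of `M` that is minimal, that is, a connected
component of `M`. -/
structure IsComponent (M : Matroid α) (D : Set α) : Prop where
  subset_ground : D ⊆ M.E
  nonempty : D.Nonempty
  circuit_subset : ∀ C, M.IsCircuit C → (C ∩ D).Nonempty → C ⊆ D
  eq_of_subset : ∀ X ⊆ D, X.Nonempty → (∀ C, M.IsCircuit C → (C ∩ X).Nonempty → C ⊆ X) → X = D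

namespace IsComponent

variable {D : Set α}

/-- A component has no proper part that is attached at a single vertex. -/
theorem meets_of_separation (hD : IsComponent M D) (hM : IsRepresentedBy M s t) {S : Set V} {v : V}
    (hne : ∃ e ∈ D, s e ∈ S ∨ t e ∈ S)
    (hSv : ∀ e ∈ D, (s e ∈ S ∨ t e ∈ S) → (s e ∈ S ∨ s e = v) ∧ (t e ∈ S ∨ t e = v)) :
    ∀ e ∈ D, s e ∈ S ∨ t e ∈ S := by
  have hX : {e ∈ D | s e ∈ S ∨ t e ∈ S} = D := by
    refine hD.eq_of_subset _ (fun _ h => h.1) hne fun C hC hCX => ?_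
    obtain ⟨a, haC, haX⟩ := hCX
    exact hM.subset_of_separation (D := D) (S := S) (v := v) (fun e he => by simp [he])
      (fun e he heX => hSv e he heX.2) hC (hD.circuit_subset C hC ⟨a, haC, haX.1⟩) ⟨a, haC, haX⟩
  intro e he
  rw [← hX] at he
  exact he.2

theorem eq_singleton_of_isLoop (hD : IsComponent M D) {e : α} (he : M.IsLoop e) (heD : e ∈ D) :
    D = {e} := by
  refine (hD.eq_of_subset {e} (by simpa using heD) ⟨e, rfl⟩ fun C hC hCe => ?_).symm
  obtain ⟨a, haC, rfl⟩ := hCe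
  rw [he.isCircuit.eq_of_subset_isCircuit hC (by simpa using haC)]

/-- A block stays connected when a vertex is removed: a level set of `f` away from `v` could be
attached to the rest of `D` only at `v`. -/
theorem exists_adj_eq (hD : IsComponent M D) (hM : IsRepresentedBy M s t)
    (hloop : ∀ e ∈ D, s e ≠ t e) {v : V} (hv : ∃ e ∈ D, s e = v ∨ t e = v) {f : V → ℚ}
    (hf : f ∈ potentials s t (D \ star s t v)) :
    ∃ c, ∀ e ∈ D, (s e = v ∨ f (s e) = c) ∧ (t e = v ∨ f (t e) = c) := by
  obtain ⟨e₀, he₀, hv⟩ := hv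
  obtain ⟨u₀, hu₀, hu₀e⟩ : ∃ u₀, u₀ ≠ v ∧ (s e₀ = u₀ ∨ t e₀ = u₀) := by
    rcases hv with rfl | rfl
    exacts [⟨_, (hloop e₀ he₀).symm, Or.inr rfl⟩, ⟨_, hloop e₀ he₀, Or.inl rfl⟩]
  have key := hD.meets_of_separation hM (S := {u | u ≠ v ∧ f u = f u₀}) (v := v)
    ⟨e₀, he₀, by
      rcases hu₀e with rfl | rfl
      exacts [Or.inl ⟨hu₀, rfl⟩, Or.inr ⟨hu₀, rfl⟩]⟩ ?_
  · refine ⟨f u₀, fun e he => ?_⟩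
    have := key e he
    have h2 : s e = v ∨ t e = v ∨ f (s e) = f (t e) := by
      by_cases hs : s e = v
      · exact Or.inl hs
      by_cases ht : t e = v
      · exact Or.inr (Or.inl ht)
      · exact Or.inr (Or.inr (hf e ⟨he, fun h => h.2.elim hs ht⟩))
    simp only [Set.mem_ofPred_eq] at this
    have h3 := hloop e he
    grind
  · intro e he h
    have h2 : s e = v ∨ t e = v ∨ f (s e) = f (t e) := by
      by_cases hs : s e = v
      · exact Or.inl hs
      by_cases ht : t e = v
      · exact Or.inr (Or.inl ht)
      · exact Or.inr (Or.inr (hf e ⟨he, fun h => h.2.elim hs ht⟩))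
    simp only [Set.mem_ofPred_eq] at h ⊢
    have h3 := hloop e he
    grind

/-- Deleting the star isolates `v` and leaves the rest of the block connected, so restoring the
single edge `e₀` at `v` already gives back the potentials of `D`. -/
theorem finrank_sdiff_star [Fintype V] [DecidableEq V] (hD : IsComponent M D)
    (hM : IsRepresentedBy M s t) (hloop : ∀ e ∈ D, s e ≠ t e) {v : V}
    (hv : ∃ e ∈ D, s e = v ∨ t e = v) :
    finrank ℚ (potentials s t (D \ star s t v)) = finrank ℚ (potentials s t D) + 1 := by
  obtain ⟨e₀, he₀, hv₀⟩ := hv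
  have hsub : D \ star s t v ⊆ D := Set.sdiff_subset
  have h1 : Pi.single v 1 ∈ potentials s t (D \ star s t v) := by
    rintro e ⟨heD, hes⟩
    have hs : s e ≠ v := fun h => hes ⟨hloop e heD, Or.inl h⟩
    have ht : t e ≠ v := fun h => hes ⟨hloop e heD, Or.inr h⟩
    simp [hs, ht]
  have hne : (Pi.single v 1 : V → ℚ) (s e₀) ≠ (Pi.single v 1 : V → ℚ) (t e₀) := by
    have h := hloop e₀ he₀
    rcases hv₀ with rfl | rfl
    · simp [h.symm]
    · simp [h]
  suffices h : potentials s t (insert e₀ (D \ star s t v)) = potentials s t D by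
    rw [← finrank_potentials_insert h1 hne, h]
  refine le_antisymm (fun f hf => ?_)
    (potentials_anti (Set.insert_subset he₀ hsub))
  obtain ⟨c, hc⟩ := hD.exists_adj_eq hM hloop ⟨e₀, he₀, hv₀⟩
    (potentials_anti (Set.subset_insert _ _) hf)
  have hfv : f v = c := by
    have h := hf e₀ (Set.mem_insert _ _)
    have h2 := hc e₀ he₀
    have h3 := hloop e₀ he₀
    grind
  intro e he
  have := hc e he
  grind

theorem finrank_add_card [Fintype V] [DecidableEq V] (hD : IsComponent M D)
    (hM : IsRepresentedBy M s t) {S : Finset V} (hS : ∀ v, v ∈ S ↔ ∃ e ∈ D, s e = v ∨ t e = v) :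
    finrank ℚ (potentials s t D) + S.card = Fintype.card V + 1 := by
  obtain ⟨e₀, he₀⟩ := hD.nonempty
  refine finrank_constOn (v₀ := s e₀) ((hS _).2 ⟨e₀, he₀, Or.inl rfl⟩) fun f => ⟨fun hf => ?_,
    fun hf e he => ?_⟩
  · have key := hD.meets_of_separation hM (S := {u | f u = f (s e₀)}) (v := s e₀)
      ⟨e₀, he₀, Or.inl rfl⟩ fun e he h => by
        have := hf e he
        simp only [Set.mem_ofPred_eq] at h ⊢
        grind
    intro u hu
    obtain ⟨e, he, hu⟩ := (hS u).1 hu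
    have h1 := key e he
    have h2 := hf e he
    simp only [Set.mem_ofPred_eq] at h1
    grind
  · rw [hf _ ((hS _).2 ⟨e, he, Or.inl rfl⟩), hf _ ((hS _).2 ⟨e, he, Or.inr rfl⟩)]

/-- The right side 1 counts the component `D` itself, so that summing over all components yields
`numComponents M`. In the loopless case the left side reduces to |V(D)| - rk(D). -/
theorem block_formula [Fintype V] [M.Finite] (hD : IsComponent M D) (hM : IsRepresentedBy M s t) :
    ((M.loops ∩ D).ncard : ℤ) + (Fintype.card V - 1) * rank (M.restrict D) -
      ∑ v, (rank (M.restrict (D \ star s t v)) : ℤ) = 1 := by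
  classical
  by_cases hloop : ∀ e ∈ D, s e ≠ t e
  · have hL : M.loops ∩ D = ∅ := by
      ext e
      simp only [Set.mem_inter_iff, Set.mem_empty_iff_false, iff_false]
      rintro ⟨h1, h2⟩
      exact hloop e h2 ((hM.isLoop_iff (hD.subset_ground h2)).1 h1)
    let S : Finset V := {v | ∃ e ∈ D, s e = v ∨ t e = v}
    have hr := rank_restrict_add_finrank hM hD.subset_ground
    have hS := hD.finrank_add_card hM (S := S) (by simp [S])
    have hv (v : V) : (rank (M.restrict (D \ star s t v)) : ℤ) =
        rank (M.restrict D) - if v ∈ S then 1 else 0 := by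
      have hr' := rank_restrict_add_finrank hM (A := D \ star s t v)
        (Set.sdiff_subset.trans hD.subset_ground)
      by_cases hvS : v ∈ S
      · have := hD.finrank_sdiff_star hM hloop (v := v) (by simpa [S] using hvS)
        rw [if_pos hvS]
        omega
      · have : D \ star s t v = D := by
          refine sdiff_eq_left.2 (Set.disjoint_left.2 fun e he h => hvS ?_)
          exact Finset.mem_filter.2 ⟨Finset.mem_univ _, e, he, h.2⟩
        rw [if_neg hvS, this, sub_zero]
    simp_rw [hv, Finset.sum_sub_distrib, hL]
    simp only [Set.ncard_empty, Finset.sum_const, Finset.card_univ, nsmul_eq_mul,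
      Finset.sum_ite_mem, Finset.univ_inter]
    push_cast
    have : (rank (M.restrict D) : ℤ) + 1 = S.card := by omega
    linarith
  · push Not at hloop
    obtain ⟨e, he, hst⟩ := hloop
    have hl := (hM.isLoop_iff (hD.subset_ground he)).2 hst
    have hDe := hD.eq_singleton_of_isLoop hl he
    have h0 (X) (hX : X ⊆ D) : rank (M.restrict X) = 0 := by
      have : M.eRk X ≤ M.eRk D := M.eRk_mono hX
      rw [hDe, hl.eRk_eq, nonpos_iff_eq_zero] at this
      simp [rank, this]
    have hLD : M.loops ∩ D = {e} := by
      rw [hDe]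
      exact Set.inter_eq_right.2 (Set.singleton_subset_iff.2 hl)
    simp [h0 D le_rfl, h0 (D \ _) Set.sdiff_subset, hLD]

end IsComponent

/-- The number of connected components of the cycle matroid of a multigraph: there is one
component for each loop, and the others are the blocks. -/
theorem IsRepresentedBy.numComponents_eq [Fintype V] [M.Finite] (hM : IsRepresentedBy M s t) :
    (numComponents M : ℤ) = M.loops.ncard + (Fintype.card V - 1) * rank M -
      ∑ v, (rank (M.restrict (M.E \ star s t v)) : ℤ) := by
  obtain ⟨g, hg, hconst, hcomp⟩ := exists_components M
  have hD (i) (hi : i < numComponents M) : IsComponent M {e | e ∈ M.E ∧ g e = i} :=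
    { subset_ground := fun _ h => h.1
      nonempty := (hcomp i hi).1
      circuit_subset := fun C hC ⟨a, haC, haD⟩ e he =>
        ⟨hC.subset_ground he, (hconst hC e he a haC).trans haD.2⟩
      eq_of_subset := (hcomp i hi).2 }
  have hsum : ∑ i ∈ Finset.range (numComponents M), (1 : ℤ) = numComponents M := by simp
  have hL : M.loops.ncard = ∑ i ∈ Finset.range (numComponents M),
      (M.loops ∩ {e | e ∈ M.E ∧ g e = i}).ncard := by
    classical
    have hfin : M.loops.Finite := M.ground_finite.subset M.loops_subset_ground
    have hLE : ∀ e ∈ M.loops, e ∈ M.E := fun e he => M.loops_subset_ground he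
    generalize M.loops = L at hfin hLE
    lift L to Finset α using hfin
    rw [Set.ncard_coe_finset, Finset.card_eq_sum_card_fiberwise (f := g)
      (t := Finset.range (numComponents M))]
    · refine Finset.sum_congr rfl fun i _ => ?_
      rw [← Set.ncard_coe_finset]
      congr 1
      ext e
      have := hLE e
      simp at this ⊢
      tauto
    · intro e he
      simpa using hg e (hLE e he)
  have hE : rank M = rank (M.restrict M.E) := by rw [Matroid.restrict_ground_eq_self]
  rw [← hsum, ← Finset.sum_congr rfl fun i hi => (hD i (Finset.mem_range.1 hi)).block_formula hM,
    Finset.sum_sub_distrib, Finset.sum_add_distrib, ← Finset.mul_sum, Finset.sum_comm, hE,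
    hconst.rank_eq_sum hg subset_rfl, hL]
  simp_rw [hconst.rank_eq_sum hg (Set.sdiff_subset : M.E \ star s t _ ⊆ _)]
  have h1 (i : ℕ) : M.E ∩ {e | g e = i} = {e | e ∈ M.E ∧ g e = i} := rfl
  have h2 (i : ℕ) (v : V) : M.E \ star s t v ∩ {e | g e = i} =
      {e | e ∈ M.E ∧ g e = i} \ star s t v := by
    ext e
    simp
    tauto
  simp_rw [h1, h2]
  push_cast
  rfl

end BlockFormula

/-! ### Contractions as quotient graphs. -/

section Contraction

variable {V : Type v} {α : Type u} {s t : α → V} {M : Matroid α} {B : Set α}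

/-- Two vertices are equivalent if they are joined by a path with edges in `B`, that is, if every
function in `potentials s t B` takes the same value at both. -/
def joined (s t : α → V) (B : Set α) : Setoid V where
  r u w := ∀ f ∈ potentials s t B, f u = f w
  iseqv := ⟨fun _ _ _ => rfl, fun h f hf => (h f hf).symm,
    fun h h' f hf => (h f hf).trans (h' f hf)⟩

/-- The vertices of the multigraph that is obtained by contracting the edges in `B`. -/
abbrev ContractVertex (s t : α → V) (B : Set α) : Type v := Quotient (joined s t B)

/-- The vertex of the contraction to which a vertex is mapped. -/
def toContract (s t : α → V) (B : Set α) (u : V) : ContractVertex s t B :=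
  Quotient.mk (joined s t B) u

theorem toContract_eq {u w : V} :
    toContract s t B u = toContract s t B w ↔ ∀ f ∈ potentials s t B, f u = f w :=
  Quotient.eq (r := joined s t B)

theorem toContract_surjective : Function.Surjective (toContract s t B) := Quotient.mk_surjective

theorem comp_toContract_mem_iff {X : Set α} {f : ContractVertex s t B → ℚ} :
    f ∘ toContract s t B ∈ potentials s t (X ∪ B) ↔
      f ∈ potentials (toContract s t B ∘ s) (toContract s t B ∘ t) X := by
  refine ⟨fun h e he => h e (Or.inl he), fun h e he => ?_⟩
  rcases he with he | he
  · exact h e he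
  · exact congr_arg f (toContract_eq.2 fun g hg => hg e he)

theorem exists_comp_toContract_eq {f : V → ℚ} (hf : f ∈ potentials s t B) :
    ∃ g : ContractVertex s t B → ℚ, g ∘ toContract s t B = f :=
  ⟨Quotient.lift f fun _ _ h => h f hf, rfl⟩

/-- Pulling back along the quotient map identifies the two spaces: a potential of `X ∪ B` is
constant on the classes of `joined s t B`. -/
theorem finrank_potentials_contract (X : Set α) :
    finrank ℚ (potentials (toContract s t B ∘ s) (toContract s t B ∘ t) X) =
      finrank ℚ (potentials s t (X ∪ B)) := by
  have hinj : Function.Injective (LinearMap.funLeft ℚ ℚ (toContract s t B)) :=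
    LinearMap.funLeft_injective_of_surjective _ _ _ toContract_surjective
  rw [LinearEquiv.finrank_eq (Submodule.equivMapOfInjective _ hinj _)]
  suffices h : (potentials (toContract s t B ∘ s) (toContract s t B ∘ t) X).map
      (LinearMap.funLeft ℚ ℚ (toContract s t B)) = potentials s t (X ∪ B) by rw [h]
  ext f
  rw [Submodule.mem_map]
  constructor
  · rintro ⟨g, hg, rfl⟩
    exact comp_toContract_mem_iff.2 hg
  · intro hf
    obtain ⟨g, rfl⟩ := exists_comp_toContract_eq (potentials_anti Set.subset_union_right hf)
    exact ⟨g, comp_toContract_mem_iff.1 hf, rfl⟩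

theorem card_contractVertex [Fintype (ContractVertex s t B)] :
    Fintype.card (ContractVertex s t B) = finrank ℚ (potentials s t B) := by
  rw [← finrank_potentials_empty (s := toContract s t B ∘ s) (t := toContract s t B ∘ t),
    finrank_potentials_contract, Set.empty_union]

theorem IsRepresentedBy.contract (hM : IsRepresentedBy M s t) (hB : B ⊆ M.E) :
    IsRepresentedBy (M.contract B) (toContract s t B ∘ s) (toContract s t B ∘ t) := by
  intro X hX e he
  rw [Matroid.contract_ground] at hX he
  rw [Matroid.contract_closure_eq, Set.mem_sdiff, and_iff_left he.2,
    hM _ (Set.union_subset (hX.trans Set.sdiff_subset) hB) e he.1]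
  constructor
  · exact fun h f hf => h _ (comp_toContract_mem_iff.2 hf)
  · intro h f hf
    obtain ⟨g, rfl⟩ := exists_comp_toContract_eq (potentials_anti Set.subset_union_right hf)
    exact h g (comp_toContract_mem_iff.1 hf)

/-- The set of vertices that are contracted to `q`. -/
noncomputable def fiber [Fintype V] (s t : α → V) (B : Set α) (q : ContractVertex s t B) :
    Finset V := by
  classical exact {u | toContract s t B u = q}

theorem mem_fiber [Fintype V] {q : ContractVertex s t B} {u : V} :
    u ∈ fiber s t B q ↔ toContract s t B u = q := by
  simp [fiber]

/-- The edges with exactly one end in `S`. -/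
def boundary (s t : α → V) (S : Finset V) : Set α := {e | ¬ (s e ∈ S ↔ t e ∈ S)}

theorem star_toContract [Fintype V] (q : ContractVertex s t B) :
    star (toContract s t B ∘ s) (toContract s t B ∘ t) q = boundary s t (fiber s t B q) := by
  ext e
  simp only [star, boundary, Function.comp_apply, Set.mem_ofPred_eq, mem_fiber]
  grind

theorem disjoint_boundary_fiber [Fintype V] (q : ContractVertex s t B) :
    Disjoint B (boundary s t (fiber s t B q)) := by
  refine Set.disjoint_left.2 fun e he h => h ?_
  rw [mem_fiber, mem_fiber, toContract_eq.2 fun f hf => hf e he]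

/-- The number of components of a contraction of a graphic matroid. -/
theorem IsRepresentedBy.numComponents_contract [Fintype V] [Fintype (ContractVertex s t B)]
    [M.Finite] (hM : IsRepresentedBy M s t) (hB : B ⊆ M.E) :
    (numComponents (M.contract B) : ℤ) = ((M.closure B).ncard : ℤ) - B.ncard +
      (finrank ℚ (potentials s t B) - 1) * rank M + rank (M.restrict B) -
      ∑ q, (rank (M.restrict (M.E \ boundary s t (fiber s t B q))) : ℤ) := by
  have hC := hM.contract hB
  have hfin : B.Finite := M.ground_finite.subset hB
  have hrk (X : Set α) (hX : X ⊆ M.E) (hBX : B ⊆ X) :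
      (rank ((M.contract B).restrict (X \ B)) : ℤ) =
        rank (M.restrict X) - rank (M.restrict B) := by
    have h1 := rank_restrict_add_finrank hC (A := X \ B) (Set.sdiff_subset_sdiff_left hX)
    rw [finrank_potentials_contract, Set.sdiff_union_of_subset hBX, card_contractVertex] at h1
    have h2 := rank_restrict_add_finrank hM hX
    have h3 := rank_restrict_add_finrank hM hB
    omega
  have hE : rank M = rank (M.restrict M.E) := by rw [Matroid.restrict_ground_eq_self]
  have hE' : rank (M.contract B) = rank ((M.contract B).restrict (M.E \ B)) := by
    rw [← Matroid.contract_ground, Matroid.restrict_ground_eq_self]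
  have hq (q : ContractVertex s t B) :
      (rank ((M.contract B).restrict ((M.E \ B) \ boundary s t (fiber s t B q))) : ℤ) =
        rank (M.restrict (M.E \ boundary s t (fiber s t B q))) - rank (M.restrict B) := by
    rw [Set.sdiff_sdiff_comm]
    exact hrk _ Set.sdiff_subset fun e he =>
      ⟨hB he, Set.disjoint_left.1 (disjoint_boundary_fiber q) he⟩
  have hcl : ((M.closure B \ B).ncard : ℤ) = (M.closure B).ncard - B.ncard := by
    have := Set.ncard_sdiff_add_ncard_of_subset (M.subset_closure B hB)
      (M.ground_finite.subset (M.closure_subset_ground B))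
    omega
  rw [hC.numComponents_eq, Matroid.contract_loops_eq, hcl, card_contractVertex, hE', hE,
    hrk _ subset_rfl hB, Matroid.contract_ground]
  simp_rw [star_toContract, hq]
  rw [Finset.sum_sub_distrib, Finset.sum_const, Finset.card_univ, card_contractVertex]
  rw [nsmul_eq_mul]
  ring

end Contraction

/-! ### Alternating sums over subsets. -/

section AlternatingSums

variable {α : Type u}

/-- The terms of `A` and `insert e A` cancel in pairs. -/
theorem sum_powerset_eq_zero_of_insert [DecidableEq α] {E : Finset α} {e : α} (he : e ∈ E)
    {F : Finset α → ℤ} (hF : ∀ A ⊆ E, e ∉ A → F (insert e A) = F A) :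
    ∑ A ∈ E.powerset, (-1) ^ A.card * F A = 0 := by
  rw [← Finset.insert_erase he, Finset.sum_powerset_insert (Finset.notMem_erase e E),
    ← Finset.sum_add_distrib]
  refine Finset.sum_eq_zero fun A hA => ?_
  have hAE := Finset.mem_powerset.1 hA
  have heA : e ∉ A := fun h => Finset.notMem_erase e E (hAE h)
  rw [hF A (hAE.trans (Finset.erase_subset _ _)) heA, Finset.card_insert_of_notMem heA]
  ring

/-- The contribution of each `e ∈ L` is cancelled by toggling some other element `f`; this is where
two elements are needed. -/
theorem sum_powerset_ncard_inter {E : Finset α} (hE : 2 ≤ E.card) {L : Set α} (hL : L ⊆ E) :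
    ∑ A ∈ E.powerset, (-1) ^ A.card * ((L ∩ A).ncard : ℤ) = 0 := by
  classical
  lift L to Finset α using E.finite_toSet.subset hL
  have h (A : Finset α) : (((L : Set α) ∩ A).ncard : ℤ) = ∑ e ∈ L, if e ∈ A then 1 else 0 := by
    rw [← Finset.coe_inter, Set.ncard_coe_finset, Finset.sum_ite_mem]
    simp
  simp_rw [h, Finset.mul_sum]
  rw [Finset.sum_comm]
  refine Finset.sum_eq_zero fun e he => ?_
  obtain ⟨f, hf, hfe⟩ := Finset.exists_mem_ne hE e
  exact sum_powerset_eq_zero_of_insert hf fun A _ _ => by simp [hfe.symm]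

/-- If the multigraph without isolated vertices that represents `M` is disconnected, then the
alternating sum of the ranks vanishes. -/
theorem sum_rank_eq_zero {V : Type v} {s t : α → V} {M : Matroid α} [M.Finite]
    (hM : IsRepresentedBy M s t) {E : Finset α}
    (hE : (E : Set α) = M.E) (hV : ∀ v, ∃ e ∈ M.E, s e = v ∨ t e = v) {f : V → ℚ}
    (hf : f ∈ potentials s t M.E) {u w : V} (huw : f u ≠ f w) :
    ∑ A ∈ E.powerset, (-1) ^ A.card * (rank (M.restrict (A : Set α)) : ℤ) = 0 := by
  classical
  -- Edges inside and outside `X` share no vertex, so `X` and its complement split `M`. The rank of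
  -- either part ignores an edge of the other part, which can be toggled.
  let X : Set α := {e | f (s e) = f u}
  let g : α → ℕ := fun e => if e ∈ X then 0 else 1
  have hX {C : Set α} (hC : M.IsCircuit C) (hCX : (C ∩ X).Nonempty) : C ⊆ X := by
    refine hM.subset_of_separation (D := M.E) (S := {v | f v = f u}) (v := u) (fun e he => ?_)
      (fun e he heX => ?_) hC hC.subset_ground hCX
    · simp [X, ← hf e he]
    · have h : f (s e) = f u := heX
      exact ⟨Or.inl h, Or.inl ((hf e he).symm.trans h)⟩
  have hg : ConstOnCircuits M g := by
    intro C hC a ha b hb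
    by_cases hCX : (C ∩ X).Nonempty
    · simp [g, hX hC hCX ha, hX hC hCX hb]
    · have h (c) (hc : c ∈ C) : c ∉ X := fun hcX => hCX ⟨c, hc, hcX⟩
      simp [g, h a ha, h b hb]
  have hlt : ∀ e ∈ M.E, g e < 2 := fun e _ => by
    simp only [g]
    split_ifs <;> norm_num
  have hzero (i : ℕ) {e : α} (he : e ∈ M.E) (hei : g e ≠ i) :
      ∑ A ∈ E.powerset, (-1) ^ A.card *
        (rank (M.restrict ((A : Set α) ∩ {e | g e = i})) : ℤ) = 0 := by
    refine sum_powerset_eq_zero_of_insert (e := e) (by rwa [← Finset.mem_coe, hE])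
      fun A _ _ => ?_
    rw [Finset.coe_insert, Set.insert_inter_of_notMem (by exact hei)]
  obtain ⟨a, ha, hau⟩ := hV u
  obtain ⟨b, hb, hbw⟩ := hV w
  have haX : a ∈ X := by
    have := hf a ha
    rcases hau with rfl | rfl
    exacts [rfl, this]
  have hbX : b ∉ X := fun h => huw <| by
    have := hf b hb
    change f (s b) = f u at h
    rcases hbw with rfl | rfl
    exacts [h.symm, h.symm.trans this]
  rw [Finset.sum_congr rfl fun A hA => by
    rw [hg.rank_eq_sum hlt (hE ▸ Finset.coe_subset.2 (Finset.mem_powerset.1 hA)),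
      Finset.sum_range_succ, Finset.sum_range_one, Nat.cast_add, mul_add],
    Finset.sum_add_distrib, hzero 0 hb (by simp [g, hbX]), hzero 1 ha (by simp [g, haX]), add_zero]

variable {V : Type v} [Fintype V] {s t : α → V} {M : Matroid α} [M.Finite]

theorem rank_restrict_insert_add (hM : IsRepresentedBy M s t) {A : Set α} (hA : A ⊆ M.E) {e : α}
    (he : e ∈ M.E) [Decidable (e ∈ M.closure A)] :
    (rank (M.restrict (insert e A)) : ℤ) + (if e ∈ M.closure A then 1 else 0) =
      rank (M.restrict A) + 1 := by
  have h1 := rank_restrict_add_finrank hM hA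
  have h2 := rank_restrict_add_finrank hM (Set.insert_subset he hA)
  split_ifs with hcl
  · rw [potentials_insert_of_forall ((hM A hA e he).1 hcl)] at h2
    omega
  · rw [hM A hA e he] at hcl
    push Not at hcl
    obtain ⟨f, hf, hfe⟩ := hcl
    have := finrank_potentials_insert hf hfe
    omega

/-- For each `e`, the difference [e ∈ cl(B)] - rk(B) is unchanged by adding `e` to `B`, so each of
the |E| elements contributes one copy of the rank sum. -/
theorem sum_powerset_ncard_closure (hM : IsRepresentedBy M s t) {E : Finset α}
    (hE : (E : Set α) = M.E) :
    ∑ B ∈ E.powerset, (-1) ^ B.card * ((M.closure B).ncard : ℤ) =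
      E.card * ∑ B ∈ E.powerset, (-1) ^ B.card * (rank (M.restrict (B : Set α)) : ℤ) := by
  classical
  have h (B : Finset α) : ((M.closure B).ncard : ℤ) =
      ∑ e ∈ E, if e ∈ M.closure B then 1 else 0 := by
    rw [Finset.sum_ite, Finset.sum_const_zero, add_zero, Finset.sum_const, ← Set.ncard_coe_finset,
      nsmul_eq_mul, mul_one]
    congr 2
    ext e
    have := @Matroid.closure_subset_ground _ M B e
    rw [← hE] at this
    simpa using this
  rw [← nsmul_eq_mul, ← Finset.sum_const]
  simp_rw [h, Finset.mul_sum]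
  rw [Finset.sum_comm]
  refine Finset.sum_congr rfl fun e he => ?_
  rw [← sub_eq_zero, ← Finset.sum_sub_distrib]
  simp_rw [← mul_sub]
  have heE : e ∈ M.E := hE ▸ he
  refine sum_powerset_eq_zero_of_insert he fun B hB _ => ?_
  have hBE : (B : Set α) ⊆ M.E := hE ▸ Finset.coe_subset.2 hB
  have h1 := rank_restrict_insert_add hM hBE heE
  have h2 : e ∈ M.closure (insert e (B : Set α)) :=
    M.mem_closure_of_mem (Set.mem_insert _ _) (Set.insert_subset heE hBE)
  rw [Finset.coe_insert, if_pos h2]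
  linarith

/-- `S` is the vertex set of a connected component of the multigraph with edge set `B`. -/
def IsFiber (s t : α → V) (B : Set α) (S : Finset V) : Prop := ∃ q, fiber s t B q = S

/-- The indicator condition says that no edge of `B` leaves `S`, the last one that `B` connects `S`.
This form avoids the quotient, whose type depends on `B`. -/
theorem isFiber_iff {B : Set α} {S : Finset V} : IsFiber s t B S ↔
    S.Nonempty ∧ (S : Set V).indicator 1 ∈ potentials s t B ∧
      ∀ f ∈ potentials s t B, ∀ u ∈ S, ∀ w ∈ S, f u = f w := by
  classical
  constructor
  · rintro ⟨q, rfl⟩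
    obtain ⟨u, rfl⟩ := toContract_surjective q
    refine ⟨⟨u, mem_fiber.2 rfl⟩, fun e he => ?_, fun f hf u hu w hw => ?_⟩
    · have : toContract s t B (s e) = toContract s t B (t e) := toContract_eq.2 fun f hf => hf e he
      simp [Set.indicator, mem_fiber, this]
    · exact toContract_eq.1 ((mem_fiber.1 hu).trans (mem_fiber.1 hw).symm) f hf
  · rintro ⟨⟨u, hu⟩, h1, h2⟩
    refine ⟨toContract s t B u, Finset.ext fun w => ?_⟩
    rw [mem_fiber, toContract_eq]
    refine ⟨fun h => ?_, fun hw f hf => h2 f hf w hw u hu⟩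
    by_contra hw
    simpa [Set.indicator, hu, hw] using h _ h1

theorem isFiber_insert_iff {B : Set α} {S : Finset V} {e : α} (hs : s e ∉ S) (ht : t e ∉ S) :
    IsFiber s t (insert e B) S ↔ IsFiber s t B S := by
  classical
  have hmem : (S : Set V).indicator 1 ∈ potentials s t (insert e B) ↔
      (S : Set V).indicator 1 ∈ potentials s t B := by
    refine ⟨fun h => potentials_anti (Set.subset_insert _ _) h, fun h => ?_⟩
    rintro a (rfl | ha)
    exacts [by simp [Set.indicator, hs, ht], h a ha]
  rw [isFiber_iff, isFiber_iff, hmem]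
  refine and_congr_right fun _ => and_congr_right fun h1 => ⟨fun h f hf u hu w hw => ?_,
    fun h f hf => h f (potentials_anti (Set.subset_insert _ _) hf)⟩
  -- Cutting `f` off outside `S` respects the edges of `B`, none of which leaves `S`, and gives 0 at
  -- both ends of `e`.
  have := h ((S : Set V).indicator f) ?_ u hu w hw
  · simpa [Set.indicator, hu, hw] using this
  · rintro a (rfl | ha)
    · simp [Set.indicator, hs, ht]
    · have h3 := h1 a ha
      have h4 := hf a ha
      simp only [Set.indicator, Finset.mem_coe, Pi.one_apply] at h3 ⊢
      split_ifs at h3 ⊢ <;> simp_all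

theorem fiber_injective {B : Set α} : Function.Injective (fiber s t B) := by
  intro q q' h
  obtain ⟨u, rfl⟩ := toContract_surjective q
  have : u ∈ fiber s t B (toContract s t B u) := mem_fiber.2 rfl
  rwa [h, mem_fiber] at this

theorem sum_fiber {B : Set α} [Fintype (ContractVertex s t B)] [DecidablePred (IsFiber s t B)]
    (h : Finset V → ℤ) :
    ∑ q, h (fiber s t B q) = ∑ S : Finset V, if IsFiber s t B S then h S else 0 := by
  classical
  rw [← Finset.sum_filter, ← Finset.sum_image (g := fiber s t B) (f := h)
    fun _ _ _ _ h => fiber_injective h]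
  refine Finset.sum_congr ?_ fun _ _ => rfl
  ext S
  simp only [Finset.mem_image, Finset.mem_univ, true_and, Finset.mem_filter]
  rfl

/-- Both sides are |V| minus the number of components of (V, B). -/
theorem sum_isFiber_card_sub_one (hM : IsRepresentedBy M s t) {B : Set α} (hB : B ⊆ M.E)
    [DecidablePred (IsFiber s t B)] :
    ∑ S : Finset V, (if IsFiber s t B S then (S.card : ℤ) - 1 else 0) =
      rank (M.restrict B) := by
  classical
  have : Fintype (ContractVertex s t B) := Fintype.ofFinite _
  rw [← sum_fiber, Finset.sum_sub_distrib, Finset.sum_const, Finset.card_univ,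
    card_contractVertex]
  have h := Finset.card_eq_sum_card_fiberwise (s := (Finset.univ : Finset V))
    (t := Finset.univ) (f := toContract s t B) fun _ _ => by simp
  have h2 (q) : Finset.filter (fun u => toContract s t B u = q) Finset.univ = fiber s t B q := by
    ext
    simp [mem_fiber]
  simp_rw [h2, Finset.card_univ] at h
  have h3 := rank_restrict_add_finrank hM hB
  rw [← Nat.cast_sum, ← h, nsmul_eq_mul, mul_one]
  omega

theorem rank_sdiff_boundary (hM : IsRepresentedBy M s t) {B : Set α} (hB : B ⊆ M.E)
    {S : Finset V} (hS : IsFiber s t B S) (hst : ∀ e ∈ M.E, s e ∈ S ∨ t e ∈ S) :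
    (rank (M.restrict (M.E \ boundary s t S)) : ℤ) = S.card - 1 := by
  classical
  have hd : Disjoint B (boundary s t S) := by
    obtain ⟨q, rfl⟩ := hS
    exact disjoint_boundary_fiber q
  obtain ⟨⟨u₀, hu₀⟩, _, h2⟩ := isFiber_iff.1 hS
  have hsub : B ⊆ M.E \ boundary s t S := fun e he => ⟨hB he, Set.disjoint_left.1 hd he⟩
  have h := finrank_constOn hu₀ (W := potentials s t (M.E \ boundary s t S)) fun f =>
    ⟨fun hf u hu => h2 f (potentials_anti hsub hf) u hu u₀ hu₀, fun hf e he => by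
      have h3 := not_not.1 he.2
      have h4 := hst e he.1
      have h5 : s e ∈ S := by tauto
      rw [hf _ h5, hf _ (h3.1 h5)]⟩
  have h' := rank_restrict_add_finrank hM (A := M.E \ boundary s t S) Set.sdiff_subset
  omega

/-- With rk(B) written as the sum of |S| - 1 over components `S`, the two sides agree for each fixed
`S`. If every edge meets `S`, the edges off the boundary lie inside `S` and have rank |S| - 1.
Otherwise an edge that misses `S` can be toggled without affecting whether `S` is a component. -/
theorem sum_powerset_sum_isFiber (hM : IsRepresentedBy M s t) {E : Finset α}
    (hE : (E : Set α) = M.E) [∀ B, DecidablePred (IsFiber s t B)] :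
    ∑ B ∈ E.powerset, (-1) ^ B.card * ∑ S : Finset V, (if IsFiber s t (B : Set α) S then
      (rank (M.restrict (M.E \ boundary s t S)) : ℤ) else 0) =
    ∑ B ∈ E.powerset, (-1) ^ B.card * (rank (M.restrict (B : Set α)) : ℤ) := by
  classical
  have hBE (B) (hB : B ∈ E.powerset) : (B : Set α) ⊆ M.E :=
    hE ▸ Finset.coe_subset.2 (Finset.mem_powerset.1 hB)
  rw [← sub_eq_zero, ← Finset.sum_sub_distrib]
  rw [Finset.sum_congr rfl fun B hB => by
    rw [← sum_isFiber_card_sub_one hM (hBE B hB), ← mul_sub, ← Finset.sum_sub_distrib,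
      Finset.mul_sum]]
  rw [Finset.sum_comm]
  refine Finset.sum_eq_zero fun S _ => ?_
  by_cases hst : ∀ e ∈ M.E, s e ∈ S ∨ t e ∈ S
  · refine Finset.sum_eq_zero fun B hB => ?_
    split_ifs with hS
    · rw [rank_sdiff_boundary hM (hBE B hB) hS hst, sub_self, mul_zero]
    · simp
  · push Not at hst
    obtain ⟨e, he, h1, h2⟩ := hst
    refine sum_powerset_eq_zero_of_insert (e := e) (by rwa [← Finset.mem_coe, hE])
      fun B _ _ => ?_
    simp only [Finset.coe_insert, isFiber_insert_iff h1 h2]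

theorem sum_powerset_finrank (hM : IsRepresentedBy M s t) {E : Finset α}
    (hE : (E : Set α) = M.E) (hne : E.Nonempty) :
    ∑ B ∈ E.powerset, (-1) ^ B.card * (finrank ℚ (potentials s t (B : Set α)) : ℤ) =
      -∑ B ∈ E.powerset, (-1) ^ B.card * (rank (M.restrict (B : Set α)) : ℤ) := by
  classical
  obtain ⟨e, he⟩ := hne
  rw [eq_neg_iff_add_eq_zero, ← Finset.sum_add_distrib,
    ← sum_powerset_eq_zero_of_insert he (F := fun _ => (Fintype.card V : ℤ)) fun _ _ _ => rfl]
  refine Finset.sum_congr rfl fun B hB => ?_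
  have := rank_restrict_add_finrank hM (A := B) (hE ▸ Finset.coe_subset.2 (Finset.mem_powerset.1 hB))
  rw [← mul_add]
  congr 1
  omega

/-- The alternating sum of the numbers of components of the contractions of a graphic matroid. -/
theorem sum_numComponents_contract (hM : IsRepresentedBy M s t) {E : Finset α}
    (hE : (E : Set α) = M.E) (hcard : 2 ≤ E.card) :
    ∑ B ∈ E.powerset, (-1) ^ B.card * (numComponents (M.contract (B : Set α)) : ℤ) =
      (E.card - rank M) *
        ∑ B ∈ E.powerset, (-1) ^ B.card * (rank (M.restrict (B : Set α)) : ℤ) := by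
  classical
  have hne : E.Nonempty := Finset.card_pos.1 (by omega)
  have hform (B) (hB : B ∈ E.powerset) :
      (-1) ^ B.card * (numComponents (M.contract (B : Set α)) : ℤ) =
      (-1) ^ B.card * ((M.closure B).ncard : ℤ) - (-1) ^ B.card * ((↑E ∩ ↑B : Set α).ncard : ℤ) +
      (-1) ^ B.card * (finrank ℚ (potentials s t (B : Set α)) : ℤ) * rank M -
      (-1) ^ B.card * 1 * rank M + (-1) ^ B.card * (rank (M.restrict (B : Set α)) : ℤ) -
      (-1) ^ B.card * ∑ S : Finset V, (if IsFiber s t (B : Set α) S then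
        (rank (M.restrict (M.E \ boundary s t S)) : ℤ) else 0) := by
    have hBE : (B : Set α) ⊆ E := Finset.coe_subset.2 (Finset.mem_powerset.1 hB)
    have : Fintype (ContractVertex s t (B : Set α)) := Fintype.ofFinite _
    rw [hM.numComponents_contract (hE ▸ hBE),
      sum_fiber fun S => (rank (M.restrict (M.E \ boundary s t S)) : ℤ),
      Set.inter_eq_right.2 hBE]
    ring
  obtain ⟨e, he⟩ := hne
  rw [Finset.sum_congr rfl hform]
  simp only [Finset.sum_add_distrib, Finset.sum_sub_distrib, ← Finset.sum_mul]
  rw [sum_powerset_sum_isFiber hM hE, sum_powerset_ncard_closure hM hE,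
    sum_powerset_ncard_inter hcard subset_rfl, sum_powerset_finrank hM hE ⟨e, he⟩,
    show ∑ B ∈ E.powerset, (-1 : ℤ) ^ B.card = 0 by
      simpa using sum_powerset_eq_zero_of_insert he (F := fun _ => 1) fun _ _ _ => rfl]
  ring

theorem sum_rank_sdiff_star (hM : IsRepresentedBy M s t) {E : Finset α}
    (hE : (E : Set α) = M.E) {v : V} (hv : ∃ e ∈ M.E, s e = v ∨ t e = v) :
    ∑ A ∈ E.powerset, (-1) ^ A.card * (rank (M.restrict ((A : Set α) \ star s t v)) : ℤ) = 0 := by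
  classical
  obtain ⟨e, he, hv⟩ := hv
  refine sum_powerset_eq_zero_of_insert (e := e) (by rwa [← Finset.mem_coe, hE]) fun A hA _ => ?_
  have hAE : (A : Set α) ⊆ M.E := hE ▸ Finset.coe_subset.2 hA
  rw [Finset.coe_insert]
  by_cases hst : s e = t e
  · have hes : e ∉ star s t v := fun h => h.1 hst
    have h := rank_restrict_insert_add hM (A := (A : Set α) \ star s t v)
      (Set.sdiff_subset.trans hAE) he
    rw [if_pos ((hM _ (Set.sdiff_subset.trans hAE) e he).2 fun f _ => by rw [hst])] at h
    rw [Set.insert_sdiff_of_notMem _ hes]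
    linarith
  · rw [Set.insert_sdiff_of_mem _ (show e ∈ star s t v from ⟨hst, hv⟩)]

/-- The alternating sum of the numbers of components of the restrictions of a graphic matroid. -/
theorem sum_numComponents_restrict (hM : IsRepresentedBy M s t) {E : Finset α}
    (hE : (E : Set α) = M.E) (hcard : 2 ≤ E.card)
    (hV : ∀ v, ∃ e ∈ M.E, s e = v ∨ t e = v) :
    ∑ A ∈ E.powerset, (-1) ^ A.card * (numComponents (M.restrict (A : Set α)) : ℤ) =
      rank M * ∑ A ∈ E.powerset, (-1) ^ A.card * (rank (M.restrict (A : Set α)) : ℤ) := by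
  classical
  have hform (A) (hA : A ∈ E.powerset) :
      (-1) ^ A.card * (numComponents (M.restrict (A : Set α)) : ℤ) =
      (-1) ^ A.card * ((M.loops ∩ A).ncard : ℤ) +
      (Fintype.card V - 1) * ((-1) ^ A.card * (rank (M.restrict (A : Set α)) : ℤ)) -
      ∑ v, (-1) ^ A.card * (rank (M.restrict ((A : Set α) \ star s t v)) : ℤ) := by
    have hAE : (A : Set α) ⊆ M.E := hE ▸ Finset.coe_subset.2 (Finset.mem_powerset.1 hA)
    have : (M.restrict (A : Set α)).Finite := Matroid.restrict_finite A.finite_toSet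
    rw [(hM.restrict hAE).numComponents_eq, Matroid.restrict_loops_eq hAE, ← Finset.mul_sum]
    simp_rw [Matroid.restrict_ground_eq,
      Matroid.restrict_restrict_eq M (Set.sdiff_subset : (A : Set α) \ star s t _ ⊆ A)]
    ring
  rw [Finset.sum_congr rfl hform, Finset.sum_sub_distrib, Finset.sum_add_distrib, Finset.sum_comm,
    Finset.sum_eq_zero fun v _ => sum_rank_sdiff_star hM hE (hV v),
    sum_powerset_ncard_inter hcard (hE ▸ M.loops_subset_ground), zero_add, sub_zero,
    ← Finset.mul_sum]
  -- If the graph is connected then |V| - 1 = rk(M); if not, the rank sum is zero and the factor is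
  -- irrelevant.
  by_cases hconst : ∀ f ∈ potentials s t M.E, ∀ u w, f u = f w
  · obtain ⟨e, he⟩ : E.Nonempty := Finset.card_pos.1 (by omega)
    have h1 := finrank_constOn (Finset.mem_univ (s e)) (W := potentials s t M.E) fun f =>
      ⟨fun hf u _ => hconst f hf u _, fun hf e _ => by
        rw [hf _ (Finset.mem_univ _), hf (t e) (Finset.mem_univ _)]⟩
    have h2 := rank_restrict_add_finrank hM subset_rfl
    rw [Matroid.restrict_ground_eq_self] at h2
    rw [Finset.card_univ] at h1
    congr 1
    omega
  · push Not at hconst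
    obtain ⟨f, hf, u, w, huw⟩ := hconst
    rw [sum_rank_eq_zero hM hE hV hf huw, mul_zero, mul_zero]

end AlternatingSums

/-! ### From cycle matroids to representations by potentials. -/

section Graphic

variable {V : Type v} {α : Type u}

/-- A function that is constant along all edges of a cycle but one is
constant along the last one, too. -/
theorem IsCycleEdgeSet.eq_of_forall {G : Graph V α} {C : Set α} (hC : IsCycleEdgeSet G C) {e : α}
    (he : e ∈ C) {f : V → ℚ} (hf : ∀ a ∈ C \ {e}, ∀ x y, G.IsLink a x y → f x = f y) {x y : V}
    (hxy : G.IsLink e x y) : f x = f y := by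
  obtain ⟨n, v, c, -, hc, hlink, rfl⟩ := hC
  obtain ⟨j, rfl⟩ := he
  -- The differences telescope around the cycle, and only the one at `e` can be nonzero.
  have hsum : ∑ i, (f (v i) - f (v (i + 1))) = 0 := by
    rw [Finset.sum_sub_distrib, sub_eq_zero]
    exact (Equiv.sum_comp (Equiv.addRight (1 : Fin (n + 1))) fun i => f (v i)).symm
  rw [Finset.sum_eq_single j (fun i _ hij => sub_eq_zero.2 <|
    hf (c i) ⟨⟨i, rfl⟩, fun h => hij (hc h)⟩ _ _ (hlink i)) (by simp), sub_eq_zero] at hsum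
  rcases (hlink j).eq_and_eq_or_eq_and_eq hxy with ⟨rfl, rfl⟩ | ⟨rfl, rfl⟩
  exacts [hsum, hsum.symm]

/-- If the ends of `e` cannot be separated by a function that is constant along all edges in `A`,
then `e` is in a cycle with edges in `A`. -/
theorem exists_isCycleEdgeSet {G : Graph V α} {A : Set α} {e : α} (heA : e ∉ A) {x y : V}
    (hxy : G.IsLink e x y)
    (h : ∀ f : V → ℚ, (∀ a ∈ A, ∀ x y, G.IsLink a x y → f x = f y) → f x = f y) :
    ∃ C ⊆ insert e A, e ∈ C ∧ IsCycleEdgeSet G C := by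
  classical
  let H : SimpleGraph V := SimpleGraph.fromRel fun u w => ∃ a ∈ A, G.IsLink a u w
  have hH {u w : V} (huw : H.Adj u w) : ∃ a ∈ A, G.IsLink a u w := by
    obtain ⟨-, ⟨a, ha, h⟩ | ⟨a, ha, h⟩⟩ := (SimpleGraph.fromRel_adj _ _ _).1 huw
    exacts [⟨a, ha, h⟩, ⟨a, ha, h.symm⟩]
  have hreach : H.Reachable x y := by
    have key := h (fun u => if H.Reachable x u then 1 else 0) fun a ha u w huw => by
      have : H.Reachable u w := by
        by_cases hne : u = w
        · rw [hne]
        · exact ((SimpleGraph.fromRel_adj _ _ _).2 ⟨hne, Or.inl ⟨a, ha, huw⟩⟩).reachable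
      have h2 : H.Reachable x u ↔ H.Reachable x w :=
        ⟨fun h => h.trans this, fun h => h.trans this.symm⟩
      simp [h2]
    by_contra hcon
    simp [hcon] at key
  obtain ⟨p, hp⟩ := hreach.exists_isPath
  have hinj {i j : ℕ} (hi : i ≤ p.length) (hj : j ≤ p.length) (hij : p.getVert i = p.getVert j) :
      i = j := hp.getVert_injOn hi hj hij
  have hadj (i : ℕ) : ∃ a, i < p.length → a ∈ A ∧ G.IsLink a (p.getVert i) (p.getVert (i + 1)) := by
    by_cases hi : i < p.length
    · obtain ⟨a, ha⟩ := hH (p.adj_getVert_succ hi)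
      exact ⟨a, fun _ => ha⟩
    · exact ⟨e, fun h => absurd h hi⟩
  choose a ha using hadj
  -- The last index carries `e`, which closes the path from `y` back to `x`.
  let c : Fin (p.length + 1) → α := fun i => if (i : ℕ) < p.length then a i else e
  refine ⟨Set.range c, ?_, ⟨Fin.last _, by simp [c]⟩, p.length, fun i => p.getVert i, c,
    fun i j hij => Fin.ext (hinj (Nat.lt_succ_iff.1 i.2) (Nat.lt_succ_iff.1 j.2) hij),
    fun i j hij => ?_, fun i => ?_, rfl⟩
  · rintro _ ⟨i, rfl⟩
    simp only [c]
    split_ifs with hi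
    exacts [Or.inr (ha i hi).1, Or.inl rfl]
  · have hi' := i.2
    have hj' := j.2
    simp only [c] at hij
    split_ifs at hij with hi hj hj
    · have h1 := (ha i hi).2
      rw [hij] at h1
      rcases h1.eq_and_eq_or_eq_and_eq (ha j hj).2 with h2 | h2
      · exact Fin.ext (hinj hi.le hj.le h2.1)
      · have h3 := hinj hi.le (by omega) h2.1
        have h4 := hinj (by omega) hj.le h2.2
        omega
    · exact absurd (hij ▸ (ha i hi).1) heA
    · exact absurd (hij ▸ (ha j hj).1) heA
    · exact Fin.ext (by omega)
  · simp only [c]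
    split_ifs with hi
    · have : ((i + 1 : Fin (p.length + 1)) : ℕ) = i + 1 := by
        rw [Fin.val_add_one_of_lt (Fin.lt_def.2 (by simpa using hi))]
      rw [this]
      exact (ha i hi).2
    · have hil : i = Fin.last _ := Fin.ext (by have := i.2; simp; omega)
      rw [hil, Fin.last_add_one]
      simpa using hxy.symm

theorem IsCycleMatroid.mem_closure_iff {G : Graph V α} {M : Matroid α} (hM : IsCycleMatroid G M)
    {A : Set α} (hA : A ⊆ M.E) {e : α} {x y : V} (hxy : G.IsLink e x y) :
    e ∈ M.closure A ↔
      ∀ f : V → ℚ, (∀ a ∈ A, ∀ x y, G.IsLink a x y → f x = f y) → f x = f y := by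
  by_cases heA : e ∈ A
  · exact iff_of_true (M.mem_closure_of_mem heA hA) fun f hf => hf e heA x y hxy
  rw [Matroid.mem_closure_iff_exists_isCircuit heA]
  constructor
  · rintro ⟨C, hCA, hC, heC⟩ f hf
    exact ((hM.2 C).1 hC).eq_of_forall heC (fun a ha => hf a ((hCA ha.1).resolve_left ha.2)) hxy
  · intro h
    obtain ⟨C, hCA, heC, hC⟩ := exists_isCycleEdgeSet heA hxy h
    exact ⟨C, hCA, (hM.2 C).2 hC, heC⟩

/-- A nonempty finite graphic matroid is represented by a multigraph on a finite vertex set without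
isolated vertices. -/
theorem IsGraphic.exists_isRepresentedBy {M : Matroid α} [M.Finite] (hM : IsGraphic.{u, v} M)
    (hne : M.E.Nonempty) :
    ∃ (V : Type v) (_ : Finite V) (s t : α → V), IsRepresentedBy M s t ∧
      ∀ v, ∃ e ∈ M.E, s e = v ∨ t e = v := by
  classical
  obtain ⟨V, G, hG⟩ := hM
  have hends (e : α) : ∃ x : V × V, e ∈ M.E → G.IsLink e x.1 x.2 := by
    by_cases he : e ∈ M.E
    · obtain ⟨x, y, h⟩ := G.exists_isLink_of_mem_edgeSet (hG.1 ▸ he)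
      exact ⟨(x, y), fun _ => h⟩
    · obtain ⟨a, ha⟩ := hne
      obtain ⟨x, y, h⟩ := G.exists_isLink_of_mem_edgeSet (hG.1 ▸ ha)
      exact ⟨(x, y), fun h => absurd h he⟩
  choose x hx using hends
  obtain ⟨e₀, he₀⟩ := hne
  -- Keeping only the ends of edges makes the vertex set finite and removes isolated vertices.
  let U : Set V := (fun e => (x e).1) '' M.E ∪ (fun e => (x e).2) '' M.E
  have hU : U.Finite := (M.ground_finite.image _).union (M.ground_finite.image _)
  have h1 {e} (he : e ∈ M.E) : (x e).1 ∈ U := Or.inl ⟨e, he, rfl⟩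
  have h2 {e} (he : e ∈ M.E) : (x e).2 ∈ U := Or.inr ⟨e, he, rfl⟩
  let s : α → U := fun e => if he : e ∈ M.E then ⟨_, h1 he⟩ else ⟨_, h1 he₀⟩
  let t : α → U := fun e => if he : e ∈ M.E then ⟨_, h2 he⟩ else ⟨_, h2 he₀⟩
  have hs {e} (he : e ∈ M.E) : (s e : V) = (x e).1 := by simp [s, he]
  have ht {e} (he : e ∈ M.E) : (t e : V) = (x e).2 := by simp [t, he]
  refine ⟨U, hU, s, t, fun A hA e he => ?_, ?_⟩
  · rw [hG.mem_closure_iff hA (hx e he)]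
    constructor
    · intro h f hf
      have := h (fun v => if hv : v ∈ U then f ⟨v, hv⟩ else 0) fun a ha y z hyz => ?_
      · simpa [h1 he, h2 he, s, t, he] using this
      · have haE := hA ha
        have hfa := hf a ha
        simp only [s, t, dif_pos haE] at hfa
        rcases (hx a haE).eq_and_eq_or_eq_and_eq hyz with ⟨rfl, rfl⟩ | ⟨rfl, rfl⟩
        · simpa [h1 haE, h2 haE] using hfa
        · simpa [h1 haE, h2 haE] using hfa.symm
    · intro h f hf
      have := h (fun v => f v) fun a ha => by
        simpa only [hs (hA ha), ht (hA ha)] using hf a ha _ _ (hx a (hA ha))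
      simpa only [hs he, ht he] using this
  · rintro ⟨v, ⟨e, he, rfl⟩ | ⟨e, he, rfl⟩⟩
    · exact ⟨e, he, Or.inl (Subtype.ext (hs he))⟩
    · exact ⟨e, he, Or.inr (Subtype.ext (ht he))⟩

end Graphic

/-! ### The cographic case. -/

section Dual

variable {α : Type u}

theorem rank_dual_restrict (M : Matroid α) [M.Finite] {A : Set α} (hA : A ⊆ M.E) :
    (rank (M✶.restrict A) : ℤ) = A.ncard + rank (M.restrict (M.E \ A)) - rank M := by
  have h := M.eRk_dual_add_eRank A hA
  have hA' : A.Finite := M.ground_finite.subset hA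
  have hfin (N : Matroid α) {X : Set α} (hX : X.Finite) : N.eRk X ≠ ⊤ :=
    (N.isRkFinite_of_finite hX).eRk_lt_top.ne
  have hM : M.eRank ≠ ⊤ := M.eRank_def ▸ hfin M M.ground_finite
  have h' := congr_arg ENat.toNat h
  rw [ENat.toNat_add (hfin _ hA') hM,
    ENat.toNat_add (hfin _ (M.ground_finite.subset Set.sdiff_subset))
    (Set.encard_ne_top_iff.2 hA')] at h'
  simp only [rank, Matroid.eRank_restrict, Set.ncard]
  omega

theorem neg_one_pow_card_sdiff {E A : Finset α} [DecidableEq α] (hA : A ⊆ E) :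
    (-1 : ℤ) ^ (E \ A).card = (-1) ^ E.card * (-1) ^ A.card := by
  rw [← Finset.card_sdiff_add_card_eq_card hA, pow_add, mul_assoc, ← pow_add, ← two_mul, pow_mul]
  simp

theorem sum_powerset_compl [DecidableEq α] (E : Finset α) (F : Finset α → ℤ) :
    ∑ A ∈ E.powerset, (-1) ^ A.card * F (E \ A) =
      (-1) ^ E.card * ∑ A ∈ E.powerset, (-1) ^ A.card * F A := by
  rw [Finset.mul_sum]
  refine Finset.sum_bij' (fun A _ => E \ A) (fun A _ => E \ A) ?_ ?_ ?_ ?_ ?_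
  · simp
  · simp
  · exact fun A hA => Finset.sdiff_sdiff_eq_self (Finset.mem_powerset.1 hA)
  · exact fun A hA => Finset.sdiff_sdiff_eq_self (Finset.mem_powerset.1 hA)
  · intro A hA
    rw [neg_one_pow_card_sdiff (Finset.mem_powerset.1 hA), ← mul_assoc, ← mul_assoc, ← pow_add,
      ← two_mul, pow_mul]
    simp

/-- The alternating sum of the numbers of components of the restrictions of a cographic matroid. -/
theorem sum_numComponents_restrict_dual {V : Type v} [Fintype V] {s t : α → V} {N : Matroid α}
    [N.Finite] (hN : IsRepresentedBy N s t) {E : Finset α} (hE : (E : Set α) = N.E)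
    (hcard : 2 ≤ E.card) :
    ∑ A ∈ E.powerset, (-1) ^ A.card * (numComponents (N✶.restrict (A : Set α)) : ℤ) =
      rank N✶ * ∑ A ∈ E.powerset, (-1) ^ A.card * (rank (N✶.restrict (A : Set α)) : ℤ) := by
  classical
  have hsub {A} (hA : A ∈ E.powerset) : (A : Set α) ⊆ N.E :=
    hE ▸ Finset.coe_subset.2 (Finset.mem_powerset.1 hA)
  have hcomp (A) (hA : A ∈ E.powerset) :
      (-1) ^ A.card * (numComponents (N✶.restrict (A : Set α)) : ℤ) =
        (-1) ^ A.card * (numComponents (N.contract ((E \ A : Finset α) : Set α)) : ℤ) := by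
    -- The dual of N/(E \ A) is N✶ with E \ A deleted, that is N✶|A.
    rw [← numComponents_dual (N.contract _), Matroid.dual_contract, Matroid.delete_eq_restrict,
      Matroid.dual_ground, ← hE, Finset.coe_sdiff,
      Set.sdiff_sdiff_cancel_left (Finset.coe_subset.2 (Finset.mem_powerset.1 hA))]
  have hrank (A) (hA : A ∈ E.powerset) :
      (-1) ^ A.card * (rank (N✶.restrict (A : Set α)) : ℤ) =
        (-1) ^ A.card * (((E : Set α) ∩ A).ncard : ℤ) +
        (-1) ^ A.card * (rank (N.restrict ((E \ A : Finset α) : Set α)) : ℤ) -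
        (-1) ^ A.card * rank N := by
    rw [rank_dual_restrict N (hsub hA), ← hE, Finset.coe_sdiff,
      Set.inter_eq_right.2 (Finset.coe_subset.2 (Finset.mem_powerset.1 hA))]
    ring
  have hNr : (rank N✶ : ℤ) = E.card - rank N := by
    have h := rank_dual_restrict N subset_rfl
    rw [← Matroid.dual_ground, Matroid.restrict_ground_eq_self, Matroid.dual_ground, sdiff_self,
      ← hE, Set.ncard_coe_finset] at h
    simpa [rank] using h
  obtain ⟨e, he⟩ : E.Nonempty := Finset.card_pos.1 (by omega)
  rw [Finset.sum_congr rfl hcomp, Finset.sum_congr rfl hrank, Finset.sum_sub_distrib,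
    Finset.sum_add_distrib,
    sum_powerset_compl E fun B => (numComponents (N.contract (B : Set α)) : ℤ),
    sum_powerset_compl E fun B => (rank (N.restrict (B : Set α)) : ℤ),
    sum_numComponents_contract hN hE hcard, sum_powerset_ncard_inter hcard subset_rfl,
    sum_powerset_eq_zero_of_insert he (F := fun _ => (rank N : ℤ)) fun _ _ _ => rfl, hNr]
  ring

end Dual

end CrapoInvariant

theorem mainTheorem2 {α : Type u} (M : Matroid α) [M.Finite]
    (hM : CrapoInvariant.IsGraphic.{u, v} M ∨ CrapoInvariant.IsCographic.{u, v} M)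
    (hcard : 2 ≤ M.E.ncard) :
    CrapoInvariant.beta M * (CrapoInvariant.rank M : ℤ) =
      (-1) ^ CrapoInvariant.rank M *
        ∑ A ∈ CrapoInvariant.subsets M,
          (-1) ^ A.card * (CrapoInvariant.numComponents (M.restrict (A : Set α)) : ℤ) := by
  have hE : (M.ground_finite.toFinset : Set α) = M.E := M.ground_finite.coe_toFinset
  have hne : M.E.Nonempty := Set.nonempty_of_ncard_ne_zero (by omega)
  rw [Set.ncard_eq_toFinset_card _ M.ground_finite] at hcard
  unfold CrapoInvariant.beta CrapoInvariant.subsets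
  rcases hM with hM | hM
  · obtain ⟨V, hV, s, t, hrep, hiso⟩ := hM.exists_isRepresentedBy hne
    have := Fintype.ofFinite V
    rw [CrapoInvariant.sum_numComponents_restrict hrep hE hcard hiso]
    ring
  · obtain ⟨V, hV, s, t, hrep, -⟩ :=
      CrapoInvariant.IsGraphic.exists_isRepresentedBy (M := M✶) hM hne
    have := Fintype.ofFinite V
    have h := CrapoInvariant.sum_numComponents_restrict_dual hrep hE hcard
    rw [M.dual_dual] at h
    rw [h]
    ring
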